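/- Let $n\ge 0$, $m\ge 2$ and $k\ge 0$ be integers. Suppose that $n$ balls are assigned independently to $m$ urns, each ball being assigned to urn $j$ with probability $1/m$ for $j=1,\ldots,m$. Let $S_j$ be the number of balls assigned to urn $j$, let $Y_j=(S_j-k+1)\mathbf{1}(S_j\ge k)$, and let $W=\sum_{j=1}^m Y_j$ be the total overflow. Assume that $\sigma^2=\operatorname{Var}(W)>0$ (with $\sigma>0$), and put $\widetilde W=\sigma^{-1}(W-\mathbb{E}W)$. Then, for $\widetilde Z\sim\mathrm{N}(0,1)$, \[ d_{\mathrm W}(\widetilde W,\widetilde Z)\le\frac{\mathbb{E}[Y_1^3]}{\sigma\,\mathbb{E}[Y_1^2]}+\sqrt{\frac{8}{\pi}}\,m\,\sigma^{-2}\Bigl((1-m)\operatorname{Cov}(Y_1,Y_2)+(\mathbb{E}Y_1)^2\Bigr), \] where $d_{\mathrm W}(U,V)=\sup_h|\mathbb{E}h(U)-\mathbb{E}h(V)|$ is the Wasserstein distance, the supremum being over all $h:\mathbb{R}\to\mathbb{R}$ with $|h(x)-h(y)|\le|x-y|$ for all $x,y\in\mathbb{R}$. -/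

import Mathlib

open MeasureTheory ProbabilityTheory

/-- The Wasserstein distance between two laws on the real line: the supremum of
`|∫ h dμ - ∫ h dν|` over all functions `h` with `|h x - h y| ≤ |x - y|`. It takes extended real
values, so that no boundedness of the set of values is presupposed. (It is meant for laws with
finite first moment, for which all these integrals converge.) -/
noncomputable def wassersteinDist (μ ν : Measure ℝ) : EReal :=
  ⨆ (h : ℝ → ℝ) (_ : LipschitzWith 1 h), ((|∫ x, h x ∂μ - ∫ x, h x ∂ν| : ℝ) : EReal)

section Urns

variable {Ω : Type*} {n m : ℕ}

/-- `X i ω` is the urn to which ball `i` is assigned; `urnCount X j ω` is the number of balls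
assigned to urn `j`. -/
def urnCount (X : Fin n → Ω → Fin m) (j : Fin m) (ω : Ω) : ℕ :=
  (Finset.univ.filter fun i : Fin n => X i ω = j).card

/-- The overflow `(S_j - k + 1) 1(S_j ≥ k)` of urn `j`, where `S_j` is the number of balls assigned
to it (each urn has room for `k - 1` balls). The subtraction is that of the real numbers. -/
noncomputable def urnOverflow (X : Fin n → Ω → Fin m) (k : ℕ) (j : Fin m) (ω : Ω) : ℝ :=
  if k ≤ urnCount X j ω then (urnCount X j ω : ℝ) - (k : ℝ) + 1 else 0

/-- The total overflow `W`, summed over all urns. -/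
noncomputable def totalOverflow (X : Fin n → Ω → Fin m) (k : ℕ) (ω : Ω) : ℝ :=
  ∑ j : Fin m, urnOverflow X k j ω

end Urns

/-- The standardisation `(W - E W) / σ`, with `σ` the standard deviation of `W`. -/
noncomputable def standardise {Ω : Type*} [MeasurableSpace Ω] (P : Measure Ω) (W : Ω → ℝ)
    (ω : Ω) : ℝ :=
  (W ω - ∫ ω', W ω' ∂P) / Real.sqrt (variance W P)

/-! ### The standard normal density, Mills ratio and tail integrals. -/

section GaussianDensity

open Filter Topology Set

local notation "φ" => gaussianPDFReal 0 1

/-! The proof is Stein's method with an approximate size-bias coupling. For a 1-Lipschitz `h`,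
`exists_stein_solution` solves `f' x - x f x = h x - E h(Z)` with `|f'| ≤ √(2/π)` and `f'`
2-Lipschitz. It remains to estimate `E[f'(W̃) - W̃ f(W̃)]`.

By exchangeability `E[W g(W)] = m E[Y₁ g(W)]`. If the urns were independent, `W` weighted by `Y₁`
would resemble `W' + Y₁`, with `W'` an independent copy of `W`, up to the contribution of one urn.
Here the urns compete for balls, and this gives a one-sided comparison (`sum_overflow_mul_le`):
`E[Y₁ φ(W)] ≤ E[Y₁ φ(W' + Y₁)]` for increasing `φ`. The reason is `meanOverflow_le_of_add_eq`: once
urn 0 has reached level `k`, each further ball in it adds exactly 1 to the overflow, while a ball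
placed elsewhere adds at most 1.

The gap in this inequality for `φ = id` is `δ = m(E Y₁)² + E[Y₁²] - E[Y₁ W] = (1-m)Cov(Y₁,Y₂) + (E
Y₁)²`. A Lipschitz `g` becomes increasing after a multiple of the identity is added to `±g`, so `δ`
controls the gap for `g` as well. A Taylor expansion of `g(W' + Y₁) - g(W')` yields the third-moment
term; `stein_bound_of_size_bias` combines the two errors. -/

lemma stdGaussianPDF_eq (x : ℝ) :
    φ x = (Real.sqrt (2 * Real.pi))⁻¹ * Real.exp (-(x ^ 2 / 2)) := by
  simp [gaussianPDFReal_def, neg_div]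

lemma stdGaussianPDF_pos (x : ℝ) : 0 < φ x := gaussianPDFReal_pos 0 1 x one_ne_zero

lemma stdGaussianPDF_neg (x : ℝ) : φ (-x) = φ x := by simp [stdGaussianPDF_eq]

lemma hasDerivAt_stdGaussianPDF (x : ℝ) : HasDerivAt φ (-x * φ x) x := by
  have h : HasDerivAt (fun x : ℝ => -(x ^ 2 / 2)) (-x) x := by
    exact ((hasDerivAt_pow 2 x).div_const 2).fun_neg.congr_deriv (by simp)
  have h2 := (h.exp).const_mul (Real.sqrt (2 * Real.pi))⁻¹
  have e : φ = fun x => (Real.sqrt (2 * Real.pi))⁻¹ * Real.exp (-(x ^ 2 / 2)) :=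
    funext stdGaussianPDF_eq
  rw [e]
  exact h2.congr_deriv (by ring)

lemma continuous_stdGaussianPDF : Continuous φ :=
  continuous_iff_continuousAt.2 fun x => (hasDerivAt_stdGaussianPDF x).continuousAt

lemma integral_stdGaussian (F : ℝ → ℝ) : ∫ x, F x ∂gaussianReal 0 1 = ∫ x, F x * φ x := by
  rw [integral_gaussianReal_eq_integral_smul one_ne_zero]
  simp [mul_comm]

lemma integrable_stdGaussian_iff (F : ℝ → ℝ) :
    Integrable F (gaussianReal 0 1) ↔ Integrable (fun x => F x * φ x) := by
  rw [gaussianReal_of_var_ne_zero 0 one_ne_zero,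
    integrable_withDensity_iff (measurable_gaussianPDF 0 1)
      (Eventually.of_forall fun x => gaussianPDF_lt_top)]
  simp only [toReal_gaussianPDF]

/-- Continuous functions of polynomial growth are integrable against the normal law. -/
lemma integrable_stdGaussian_of_le_pow {F : ℝ → ℝ} (hF : Continuous F) (C : ℝ) (k : ℕ)
    (hC : ∀ x, |F x| ≤ C * (1 + |x|) ^ k) : Integrable F (gaussianReal 0 1) := by
  have h1 : MemLp (fun x : ℝ => 1 + |x|) (k : ENNReal) (gaussianReal 0 1) := by
    have h2 : MemLp (fun x : ℝ => |x|) (k : ENNReal) (gaussianReal 0 1) :=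
      (memLp_id_gaussianReal' (μ := 0) (v := 1) (k : ENNReal) (by simp)).norm
    exact (memLp_const (1 : ℝ)).add h2
  have h2 : Integrable (fun x : ℝ => C * ‖1 + |x|‖ ^ k) (gaussianReal 0 1) :=
    (h1.integrable_norm_pow').const_mul C
  refine h2.mono' hF.aestronglyMeasurable (Eventually.of_forall fun x => ?_)
  have : ‖1 + |x|‖ = 1 + |x| := by
    rw [Real.norm_eq_abs, abs_of_nonneg (by positivity)]
  rw [this]
  exact hC x

lemma tendsto_stdGaussianPDF_atTop : Tendsto φ atTop (𝓝 0) := by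
  have h : Tendsto (fun x : ℝ => -(x ^ 2 / 2)) atTop atBot := by
    refine tendsto_neg_atTop_atBot.comp ?_
    exact (tendsto_pow_atTop two_ne_zero).atTop_div_const (by norm_num)
  have := (Real.tendsto_exp_atBot.comp h).const_mul (Real.sqrt (2 * Real.pi))⁻¹
  rw [mul_zero] at this
  exact this.congr fun x => (stdGaussianPDF_eq x).symm

/-- A lower bound for the Mills ratio. -/
lemma mills_ratio_lower (x : ℝ) : x / (1 + x ^ 2) * φ x ≤ ∫ t in Ioi x, φ t := by
  have hpos : ∀ t : ℝ, 0 < 1 + t ^ 2 := fun t => by positivity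
  -- This is the derivative of `-t/(1+t²) φ(t)`. It is at most `φ`, so integrating it over the tail
  -- gives the bound.
  set g' : ℝ → ℝ := fun t => (1 - 2 / (1 + t ^ 2) ^ 2) * φ t
  have hd : ∀ t ∈ Ici x, HasDerivAt (fun t => -(t / (1 + t ^ 2) * φ t)) (g' t) t := by
    intro t _
    have h1 : HasDerivAt (fun t : ℝ => 1 + t ^ 2) (2 * t) t := by
      exact ((hasDerivAt_pow 2 t).const_add 1).congr_deriv (by simp)
    refine (((hasDerivAt_id' t).fun_div h1 (hpos t).ne').fun_mul
      (hasDerivAt_stdGaussianPDF t)).fun_neg.congr_deriv ?_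
    have := (hpos t).ne'
    simp only [g']
    field_simp
    ring
  have hcont : Continuous g' := by
    refine Continuous.mul ?_ continuous_stdGaussianPDF
    refine continuous_const.sub (Continuous.div continuous_const (by fun_prop) fun t => ?_)
    exact (pow_pos (hpos t) 2).ne'
  have hb : ∀ t : ℝ, |1 - 2 / (1 + t ^ 2) ^ 2| ≤ 1 := by
    intro t
    have h1 : 1 ≤ (1 + t ^ 2) ^ 2 := one_le_pow₀ (by nlinarith [sq_nonneg t])
    have h2 : 2 / (1 + t ^ 2) ^ 2 ≤ 2 := by
      rw [div_le_iff₀ (by linarith)]; linarith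
    have h3 : 0 ≤ 2 / (1 + t ^ 2) ^ 2 := by positivity
    rw [abs_le]; constructor <;> linarith
  have hint : Integrable g' := by
    refine (integrable_gaussianPDFReal 0 1).mono' hcont.aestronglyMeasurable
      (Eventually.of_forall fun t => ?_)
    rw [Real.norm_eq_abs, abs_mul, abs_of_pos (stdGaussianPDF_pos t)]
    exact mul_le_of_le_one_left (stdGaussianPDF_pos t).le (hb t)
  have hlim : Tendsto (fun t => -(t / (1 + t ^ 2) * φ t)) atTop (𝓝 0) := by
    refine squeeze_zero_norm (fun t => ?_) tendsto_stdGaussianPDF_atTop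
    rw [norm_neg, Real.norm_eq_abs, abs_mul, abs_of_pos (stdGaussianPDF_pos t)]
    refine mul_le_of_le_one_left (stdGaussianPDF_pos t).le ?_
    rw [abs_div, abs_of_pos (hpos t), div_le_one (hpos t), abs_le]
    constructor <;> nlinarith [sq_nonneg (t - 1), sq_nonneg (t + 1)]
  have := integral_Ioi_of_hasDerivAt_of_tendsto' hd hint.integrableOn hlim
  have h2 : ∫ t in Ioi x, g' t ≤ ∫ t in Ioi x, φ t := by
    refine integral_mono hint.integrableOn (integrable_gaussianPDFReal 0 1).integrableOn fun t => ?_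
    refine mul_le_of_le_one_left (stdGaussianPDF_pos t).le ((abs_le.1 (hb t)).2)
  linarith

lemma mills_ratio_lower' (x : ℝ) : -x / (1 + x ^ 2) * φ x ≤ ∫ t in Iic x, φ t := by
  have h := mills_ratio_lower (-x)
  rw [stdGaussianPDF_neg, neg_sq] at h
  refine h.trans_eq ?_
  rw [← integral_comp_neg_Iic]
  simp [stdGaussianPDF_neg]

/-- Tail integrals of increasing centred functions. -/
lemma tail_integral_ge_of_monotone {u : ℝ → ℝ} (hu : Monotone u)
    (hint : Integrable fun t => u t * φ t) (h0 : ∫ t, u t * φ t = 0) (x : ℝ) :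
    x / (1 + x ^ 2) * φ x * u x ≤ ∫ t in Ioi x, u t * φ t := by
  have hφ := stdGaussianPDF_pos
  have hsplit : (∫ t in Iic x, u t * φ t) + ∫ t in Ioi x, u t * φ t = 0 := by
    rw [intervalIntegral.integral_Iic_add_Ioi hint.integrableOn hint.integrableOn, h0]
  have hφi := integrable_gaussianPDFReal 0 1
  have hr : u x * ∫ t in Ioi x, φ t ≤ ∫ t in Ioi x, u t * φ t := by
    rw [← integral_const_mul]
    refine setIntegral_mono_on (hφi.const_mul _).integrableOn hint.integrableOn measurableSet_Ioi
      fun t ht => ?_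
    exact mul_le_mul_of_nonneg_right (hu (le_of_lt ht)) (hφ t).le
  have hl : ∫ t in Iic x, u t * φ t ≤ u x * ∫ t in Iic x, φ t := by
    rw [← integral_const_mul]
    refine setIntegral_mono_on hint.integrableOn (hφi.const_mul _).integrableOn measurableSet_Iic
      fun t ht => ?_
    exact mul_le_mul_of_nonneg_right (hu ht) (hφ t).le
  have m1 := mills_ratio_lower x
  have m2 := mills_ratio_lower' x
  -- For `u x ≥ 0` the right tail is bounded directly. For `u x ≤ 0` centring turns it into minus
  -- the left tail, where the reflected Mills bound applies.
  rcases le_total 0 (u x) with hux | hux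
  · nlinarith
  · have e : -x / (1 + x ^ 2) * φ x = -(x / (1 + x ^ 2) * φ x) := by ring
    rw [e] at m2
    nlinarith

lemma integral_Ioi_mul_hasDerivAt {u : ℝ → ℝ} (hu : Continuous u)
    (hint : Integrable fun t => u t * φ t) (x : ℝ) :
    HasDerivAt (fun x => ∫ t in Ioi x, u t * φ t) (-(u x * φ x)) x := by
  have hc : Continuous fun t => u t * φ t := hu.mul continuous_stdGaussianPDF
  have e : (fun x => ∫ t in Ioi x, u t * φ t) =
      fun x => (∫ t in Ioi 0, u t * φ t) - ∫ t in (0 : ℝ)..x, u t * φ t := by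
    funext y
    rw [← intervalIntegral.integral_interval_add_Ioi (a := 0) (b := y)
      hint.integrableOn (hint.integrableOn)]
    ring
  rw [e]
  exact (intervalIntegral.integral_hasDerivAt_right (hc.intervalIntegrable _ _)
    (hc.stronglyMeasurableAtFilter _ _) hc.continuousAt).const_sub _

end GaussianDensity

/-! ### The Stein equation and a rotation formula for its solution. -/

section SteinEquation

open Filter Topology Set

local notation "φ" => gaussianPDFReal 0 1
local notation "γ" => gaussianReal 0 1

/-- The bounded solution of the Stein equation `f' x - x * f x = u x`, for centred `u`. -/
noncomputable def steinSolution (u : ℝ → ℝ) (x : ℝ) : ℝ :=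
  -(∫ t in Ioi x, u t * φ t) / φ x

lemma hasDerivAt_steinSolution {u : ℝ → ℝ} (hu : Continuous u)
    (hint : Integrable fun t => u t * φ t) (x : ℝ) :
    HasDerivAt (steinSolution u) (x * steinSolution u x + u x) x := by
  have hφ := (stdGaussianPDF_pos x).ne'
  refine ((integral_Ioi_mul_hasDerivAt hu hint x).fun_neg.fun_div
    (hasDerivAt_stdGaussianPDF x) hφ).congr_deriv ?_
  simp only [steinSolution]
  field_simp
  ring

/-- The left side is the derivative of `x ↦ x f(x)` for the Stein solution `f`. After multiplication
by `φ x / (1 + x²)`, its sign is exactly the tail estimate for increasing centred functions. -/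
lemma steinSolution_monotone_le {u : ℝ → ℝ} (hu : Monotone u)
    (hint : Integrable fun t => u t * φ t) (h0 : ∫ t, u t * φ t = 0) (x : ℝ) :
    (1 + x ^ 2) * steinSolution u x + x * u x ≤ 0 := by
  have h := tail_integral_ge_of_monotone hu hint h0 x
  have hφ := stdGaussianPDF_pos x
  have h1 : 0 < 1 + x ^ 2 := by positivity
  have e : (1 + x ^ 2) * steinSolution u x + x * u x =
      (1 + x ^ 2) / φ x * (x / (1 + x ^ 2) * φ x * u x - ∫ t in Ioi x, u t * φ t) := by
    simp only [steinSolution]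
    field_simp
    ring
  rw [e]
  exact mul_nonpos_of_nonneg_of_nonpos (by positivity) (by linarith)

lemma integrable_id_mul_stdGaussianPDF : Integrable fun t => t * φ t := by
  rw [← integrable_stdGaussian_iff fun t => t]
  exact integrable_stdGaussian_of_le_pow continuous_id 1 1 fun x => by simp

lemma integral_Ioi_id_mul_stdGaussianPDF (x : ℝ) : ∫ t in Ioi x, t * φ t = φ x := by
  have hd : ∀ t ∈ Ici x, HasDerivAt (fun t => -φ t) (t * φ t) t := fun t _ =>
    (hasDerivAt_stdGaussianPDF t).fun_neg.congr_deriv (by ring)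
  have hlim : Tendsto (fun t => -φ t) atTop (𝓝 0) := by
    simpa using tendsto_stdGaussianPDF_atTop.neg
  rw [integral_Ioi_of_hasDerivAt_of_tendsto' hd integrable_id_mul_stdGaussianPDF.integrableOn hlim]
  ring

lemma integral_abs_stdGaussian : ∫ z, |z| ∂γ = Real.sqrt (2 / Real.pi) := by
  rw [integral_stdGaussian]
  have e : (fun z : ℝ => |z| * φ z) = fun z => (fun t => t * φ t) |z| := by
    funext z
    simp [stdGaussianPDF_eq]
  rw [e, integral_comp_abs (f := fun t => t * φ t), integral_Ioi_id_mul_stdGaussianPDF,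
    stdGaussianPDF_eq]
  have hpi := Real.pi_pos
  rw [eq_comm, Real.sqrt_eq_iff_mul_self_eq (by positivity) (by positivity)]
  simp only [ne_eq, OfNat.ofNat_ne_zero, not_false_eq_true, zero_pow, zero_div, neg_zero,
    Real.exp_zero, mul_one]
  have h := Real.mul_self_sqrt (show 0 ≤ 2 * Real.pi by positivity)
  have hs : Real.sqrt (2 * Real.pi) ≠ 0 := by positivity
  field_simp
  rw [Real.sq_sqrt (by positivity)]

/-- Gaussian integration by parts. -/
lemma integral_mul_stdGaussian {v v' : ℝ → ℝ} (hv : ∀ z, HasDerivAt v (v' z) z)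
    (hv' : Continuous v') {C : ℝ} {k : ℕ} (hC : ∀ z, |v z| ≤ C * (1 + |z|) ^ k)
    (hC' : ∀ z, |v' z| ≤ C * (1 + |z|) ^ k) : ∫ z, z * v z ∂γ = ∫ z, v' z ∂γ := by
  have hvc : Continuous v := continuous_iff_continuousAt.2 fun z => (hv z).continuousAt
  have i1 := (integrable_stdGaussian_iff v).1 (integrable_stdGaussian_of_le_pow hvc C k hC)
  have i2 := (integrable_stdGaussian_iff v').1 (integrable_stdGaussian_of_le_pow hv' C k hC')
  have i3 : Integrable fun z => (z * v z) * φ z := by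
    refine (integrable_stdGaussian_iff fun z => z * v z).1
      (integrable_stdGaussian_of_le_pow (by fun_prop) C (k + 1) fun z => ?_)
    rw [abs_mul, pow_succ, ← mul_assoc, mul_comm]
    exact mul_le_mul (hC z) (by linarith) (abs_nonneg _) ((abs_nonneg _).trans (hC z))
  have := integral_mul_deriv_eq_deriv_mul_of_integrable (u := v) (u' := v') (v := φ)
    (v' := fun z => -z * φ z) (fun z _ => hv z) (fun z _ => hasDerivAt_stdGaussianPDF z)
    (by
      refine i3.neg.congr (Eventually.of_forall fun z => ?_)
      simp only [Pi.neg_apply, Pi.mul_apply]; ring) i2 i1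
  rw [integral_stdGaussian, integral_stdGaussian]
  have e : ∫ z, v z * (-z * φ z) = -∫ z, z * v z * φ z := by
    rw [← integral_neg]; congr 1; funext z; ring
  linarith

lemma abs_rotation_le (x z θ : ℝ) : |x * Real.cos θ + z * Real.sin θ| ≤ |x| + |z| := by
  refine (abs_add_le _ _).trans ?_
  rw [abs_mul, abs_mul]
  have h1 := Real.abs_cos_le_one θ
  have h2 := Real.abs_sin_le_one θ
  have := mul_le_of_le_one_right (abs_nonneg x) h1
  have := mul_le_of_le_one_right (abs_nonneg z) h2
  linarith

lemma growth_rotation {v : ℝ → ℝ} {C : ℝ} {k : ℕ} (hC : ∀ z, |v z| ≤ C * (1 + |z|) ^ k)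
    (x θ z : ℝ) :
    |v (x * Real.cos θ + z * Real.sin θ)| ≤ C * (1 + |x|) ^ k * (1 + |z|) ^ k := by
  have hC0 : 0 ≤ C := by
    have := (abs_nonneg _).trans (hC 0)
    simpa using this
  refine (hC _).trans ?_
  rw [mul_assoc, ← mul_pow]
  have h := abs_rotation_le x z θ
  have h2 : 0 ≤ |x| * |z| := by positivity
  gcongr
  nlinarith

/-- An interpolation formula for solutions of the Stein equation. -/
lemma stein_rotation_formula {f f' u : ℝ → ℝ} (hf : ∀ x, HasDerivAt f (f' x) x)
    (hf' : Continuous f') (hu : ∀ x, f' x - x * f x = u x) {C : ℝ} {k : ℕ}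
    (hC : ∀ x, |f x| ≤ C * (1 + |x|) ^ k) (hC' : ∀ x, |f' x| ≤ C * (1 + |x|) ^ k) (x : ℝ) :
    f x = -∫ θ in (0 : ℝ)..(Real.pi / 2),
      ∫ z, z * u (x * Real.cos θ + z * Real.sin θ) ∂γ := by
  have hfc : Continuous f := continuous_iff_continuousAt.2 fun z => (hf z).continuousAt
  have huc : Continuous u := by
    have : u = fun x => f' x - x * f x := funext fun x => (hu x).symm
    rw [this]; fun_prop
  have hC0 : 0 ≤ C := by simpa using (abs_nonneg _).trans (hC 0)
  set D : ℝ := C * (1 + |x|) ^ k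
  have hD0 : 0 ≤ D := by positivity
  have g1 : ∀ θ z, |f (x * Real.cos θ + z * Real.sin θ)| ≤ D * (1 + |z|) ^ k :=
    fun θ z => growth_rotation hC x θ z
  have g2 : ∀ θ z, |f' (x * Real.cos θ + z * Real.sin θ)| ≤ D * (1 + |z|) ^ k :=
    fun θ z => growth_rotation hC' x θ z
  have gz : ∀ {v : ℝ → ℝ} {B : ℝ} {l : ℕ}, (∀ z, |v z| ≤ B * (1 + |z|) ^ l) →
      ∀ z, |z * v z| ≤ B * (1 + |z|) ^ (l + 1) := by
    intro v B l h z
    rw [abs_mul, pow_succ, ← mul_assoc, mul_comm]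
    exact mul_le_mul (h z) (by linarith) (abs_nonneg _) ((abs_nonneg _).trans (h z))
  have gup : ∀ {v : ℝ → ℝ} {l : ℕ}, (∀ z, |v z| ≤ D * (1 + |z|) ^ l) →
      ∀ z, |v z| ≤ D * (1 + |z|) ^ (l + 1) := by
    intro v l h z
    refine (h z).trans (mul_le_mul_of_nonneg_left ?_ hD0)
    exact pow_le_pow_right₀ (by linarith [abs_nonneg z]) (Nat.le_succ l)
  have hder : ∀ θ, HasDerivAt (fun θ => ∫ z, f (x * Real.cos θ + z * Real.sin θ) ∂γ)
      (∫ z, f' (x * Real.cos θ + z * Real.sin θ) * (-x * Real.sin θ + z * Real.cos θ) ∂γ) θ := by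
    intro θ
    refine (hasDerivAt_integral_of_dominated_loc_of_deriv_le
      (F := fun θ z => f (x * Real.cos θ + z * Real.sin θ))
      (F' := fun θ z => f' (x * Real.cos θ + z * Real.sin θ) * (-x * Real.sin θ + z * Real.cos θ))
      (bound := fun z => (D * (1 + |z|) ^ k) * ((1 + |x|) * (1 + |z|)))
      univ_mem (Eventually.of_forall fun θ => ?_) ?_ ?_
      (Eventually.of_forall fun z θ _ => ?_) ?_ (Eventually.of_forall fun z θ _ => ?_)).2
    · exact Continuous.aestronglyMeasurable (by fun_prop)
    · exact integrable_stdGaussian_of_le_pow (by fun_prop) D k (g1 θ)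
    · exact Continuous.aestronglyMeasurable (by fun_prop)
    · rw [norm_mul, Real.norm_eq_abs, Real.norm_eq_abs]
      refine mul_le_mul (g2 θ z) ?_ (abs_nonneg _) (by positivity)
      -- The derivative in `θ` of the rotated point is itself a rotation, of `(-x, z)` by the
      -- complementary angle.
      have h := abs_rotation_le (-x) z (Real.pi / 2 - θ)
      rw [Real.cos_pi_div_two_sub, Real.sin_pi_div_two_sub, abs_neg] at h
      nlinarith [abs_nonneg x, abs_nonneg z, mul_nonneg (abs_nonneg x) (abs_nonneg z)]
    · refine integrable_stdGaussian_of_le_pow (by fun_prop) (D * (1 + |x|)) (k + 1) fun z => ?_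
      rw [abs_of_nonneg (by positivity)]
      apply le_of_eq; ring
    · have h1 : HasDerivAt (fun θ => x * Real.cos θ + z * Real.sin θ)
          (-x * Real.sin θ + z * Real.cos θ) θ :=
        (((Real.hasDerivAt_cos θ).const_mul x).fun_add
          ((Real.hasDerivAt_sin θ).const_mul z)).congr_deriv (by ring)
      exact (hf _).comp θ h1
  -- The function `cos θ · E f(x cos θ + Z sin θ)` runs from `f x` at `0` to `0` at `π/2`. Gaussian
  -- integration by parts and the Stein equation reduce its derivative to an expression in `u`
  -- alone.
  have key : ∀ θ, HasDerivAt
      (fun θ => Real.cos θ * ∫ z, f (x * Real.cos θ + z * Real.sin θ) ∂γ)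
      (∫ z, z * u (x * Real.cos θ + z * Real.sin θ) ∂γ) θ := by
    intro θ
    refine ((Real.hasDerivAt_cos θ).fun_mul (hder θ)).congr_deriv ?_
    set c := Real.cos θ
    set s := Real.sin θ
    have hcs : c ^ 2 = 1 - s ^ 2 := by rw [eq_sub_iff_add_eq]; exact Real.cos_sq_add_sin_sq θ
    have hs1 : |s| ≤ 1 := Real.abs_sin_le_one θ
    have hXd : ∀ z, HasDerivAt (fun z => f (x * c + z * s)) (s * f' (x * c + z * s)) z := by
      intro z
      have h1 : HasDerivAt (fun z => x * c + z * s) s z := by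
        simpa using ((hasDerivAt_id' z).mul_const s).const_add (x * c)
      exact ((hf _).comp z h1).congr_deriv (by ring)
    have i0 : Integrable (fun z => f (x * c + z * s)) γ :=
      integrable_stdGaussian_of_le_pow (by fun_prop) D k (g1 θ)
    have i0' : Integrable (fun z => f' (x * c + z * s)) γ :=
      integrable_stdGaussian_of_le_pow (by fun_prop) D k (g2 θ)
    have i1 : Integrable (fun z => z * f (x * c + z * s)) γ :=
      integrable_stdGaussian_of_le_pow (by fun_prop) D (k + 1) (gz (g1 θ))
    have i1' : Integrable (fun z => z * f' (x * c + z * s)) γ :=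
      integrable_stdGaussian_of_le_pow (by fun_prop) D (k + 1) (gz (g2 θ))
    have i2 : Integrable (fun z => z * (z * f (x * c + z * s))) γ :=
      integrable_stdGaussian_of_le_pow (by fun_prop) D (k + 2) (gz (gz (g1 θ)))
    have gs : ∀ {v : ℝ → ℝ} {l : ℕ}, (∀ z, |v z| ≤ D * (1 + |z|) ^ l) →
        ∀ z, |s * v z| ≤ D * (1 + |z|) ^ l := by
      intro v l h z
      rw [abs_mul]
      exact (mul_le_of_le_one_left (abs_nonneg _) hs1).trans (h z)
    have ibp1 : ∫ z, z * f (x * c + z * s) ∂γ = s * ∫ z, f' (x * c + z * s) ∂γ := by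
      rw [← integral_const_mul]
      exact integral_mul_stdGaussian hXd (by fun_prop) (g1 θ) (gs (g2 θ))
    have ibp2 : ∫ z, z * (z * f (x * c + z * s)) ∂γ =
        (∫ z, f (x * c + z * s) ∂γ) + s * ∫ z, z * f' (x * c + z * s) ∂γ := by
      rw [← integral_const_mul, ← integral_add i0 (i1'.const_mul s)]
      refine integral_mul_stdGaussian (C := 2 * D) (k := k + 1) (fun z => ?_) (by fun_prop)
        (fun z => ?_) fun z => ?_
      · exact ((hasDerivAt_id' z).fun_mul (hXd z)).congr_deriv (by ring)
      · refine (gz (g1 θ) z).trans (mul_le_mul_of_nonneg_right (by linarith) (by positivity))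
      · refine (abs_add_le _ _).trans ?_
        have a1 := gup (g1 θ) z
        have a2 := gs (gz (g2 θ)) z
        linarith
    have e1 : ∫ z, f' (x * c + z * s) * (-x * s + z * c) ∂γ =
        -x * s * (∫ z, f' (x * c + z * s) ∂γ) + c * ∫ z, z * f' (x * c + z * s) ∂γ := by
      rw [← integral_const_mul, ← integral_const_mul,
        ← integral_add (i0'.const_mul _) (i1'.const_mul _)]
      congr 1; funext z; ring
    have e2 : ∫ z, z * u (x * c + z * s) ∂γ = (∫ z, z * f' (x * c + z * s) ∂γ) -
        (x * c * (∫ z, z * f (x * c + z * s) ∂γ) + s * ∫ z, z * (z * f (x * c + z * s)) ∂γ) := by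
      rw [← integral_const_mul, ← integral_const_mul,
        ← integral_add (i1.const_mul _) (i2.const_mul _),
        ← integral_sub i1' ((i1.const_mul _).fun_add (i2.const_mul _))]
      congr 1; funext z; rw [← hu]; ring
    rw [e1, e2, ibp1, ibp2]
    linear_combination (∫ z, z * f' (x * c + z * s) ∂γ) * hcs
  have hucg : ∀ θ z, |u (x * Real.cos θ + z * Real.sin θ)| ≤
      (D * (2 + |x|)) * (1 + |z|) ^ (k + 1) := by
    intro θ z
    rw [← hu]
    refine (abs_sub _ _).trans ?_
    rw [abs_mul]
    have a1 := gup (g2 θ) z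
    have a2 := mul_le_mul (abs_rotation_le x z θ) (g1 θ z) (abs_nonneg _) (by positivity)
    have a3 : (|x| + |z|) * (D * (1 + |z|) ^ k) ≤ D * (1 + |x|) * (1 + |z|) ^ (k + 1) := by
      rw [pow_succ]
      have : |x| + |z| ≤ (1 + |x|) * (1 + |z|) := by
        nlinarith [abs_nonneg x, abs_nonneg z, mul_nonneg (abs_nonneg x) (abs_nonneg z)]
      calc _ ≤ ((1 + |x|) * (1 + |z|)) * (D * (1 + |z|) ^ k) :=
            mul_le_mul_of_nonneg_right this (by positivity)
        _ = _ := by ring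
    nlinarith
  have hcont : Continuous fun θ => ∫ z, z * u (x * Real.cos θ + z * Real.sin θ) ∂γ := by
    refine MeasureTheory.continuous_of_dominated (bound := fun z => (D * (2 + |x|)) * (1 + |z|) ^ (k + 1 + 1))
      (fun θ => Continuous.aestronglyMeasurable (by fun_prop))
      (fun θ => Eventually.of_forall fun z => gz (hucg θ) z)
      ?_ (Eventually.of_forall fun z => by fun_prop)
    refine integrable_stdGaussian_of_le_pow (by fun_prop) (D * (2 + |x|)) (k + 1 + 1) fun z => ?_
    rw [abs_of_nonneg (by positivity)]
  have h := intervalIntegral.integral_eq_sub_of_hasDerivAt (a := 0) (b := Real.pi / 2)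
    (fun θ _ => key θ) (hcont.intervalIntegrable _ _)
  rw [h]
  simp

end SteinEquation

/-! ### Derivative bounds for Lipschitz test functions. -/

section SteinBounds

open Filter Topology Set

local notation "φ" => gaussianPDFReal 0 1
local notation "γ" => gaussianReal 0 1

lemma LipschitzWith.abs_sub_le_real {h : ℝ → ℝ} (hh : LipschitzWith 1 h) (x y : ℝ) :
    |h x - h y| ≤ |x - y| := by
  simpa [Real.dist_eq] using hh.dist_le_mul x y

lemma LipschitzWith.growth_le {h : ℝ → ℝ} (hh : LipschitzWith 1 h) (x : ℝ) :
    |h x| ≤ (1 + |h 0|) * (1 + |x|) ^ 1 := by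
  have h1 := hh.abs_sub_le_real x 0
  rw [sub_zero] at h1
  have h2 := abs_add_le (h x - h 0) (h 0)
  rw [sub_add_cancel] at h2
  nlinarith [abs_nonneg x, abs_nonneg (h 0), mul_nonneg (abs_nonneg x) (abs_nonneg (h 0))]

lemma steinSolution_add {u v : ℝ → ℝ} (hu : Integrable fun t => u t * φ t)
    (hv : Integrable fun t => v t * φ t) (x : ℝ) :
    steinSolution (fun t => u t + v t) x = steinSolution u x + steinSolution v x := by
  simp only [steinSolution, add_mul]
  rw [integral_add hu.integrableOn hv.integrableOn]
  ring

lemma steinSolution_neg (u : ℝ → ℝ) (x : ℝ) :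
    steinSolution (fun t => -u t) x = -steinSolution u x := by
  simp only [steinSolution, neg_mul]
  rw [integral_neg]
  ring

lemma steinSolution_id (x : ℝ) : steinSolution (fun t => t) x = -1 := by
  have := (stdGaussianPDF_pos x).ne'
  rw [steinSolution, integral_Ioi_id_mul_stdGaussianPDF]
  field_simp

/-- For a `1`-Lipschitz centred `u`, the function `x ↦ x * steinSolution u x` has derivative bounded
by `1`. -/
lemma abs_deriv_id_mul_steinSolution_le {u : ℝ → ℝ} (hu : LipschitzWith 1 u)
    (hint : Integrable fun t => u t * φ t) (h0 : ∫ t, u t * φ t = 0) (x : ℝ) :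
    |(1 + x ^ 2) * steinSolution u x + x * u x| ≤ 1 := by
  have hid0 : ∫ t, t * φ t = 0 := by
    rw [← integral_stdGaussian fun t => t]
    exact integral_id_gaussianReal
  have hidi := integrable_id_mul_stdGaussianPDF
  have hl := hu.abs_sub_le_real
  -- Both `t + u` and `t - u` are increasing and centred, and the Stein solution for the identity is
  -- `-1`, contributing `-(1 + x²) + x² = -1`. The two one-sided bounds together give the absolute
  -- bound.
  have m1 : Monotone fun t => u t + t := by
    intro a b hab
    have := (abs_le.1 (hl a b)).2
    rw [abs_of_nonpos (by linarith)] at this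
    simp only; linarith
  have m2 : Monotone fun t => -u t + t := by
    intro a b hab
    have := (abs_le.1 (hl a b)).1
    rw [abs_of_nonpos (by linarith)] at this
    simp only; linarith
  have hneg : Integrable fun t => -u t * φ t := by simpa using hint.neg
  have e1 := steinSolution_monotone_le m1 ((hint.add hidi).congr
    (Eventually.of_forall fun t => (add_mul (u t) t (φ t)).symm))
    (by simp only [add_mul]; rw [integral_add hint hidi, h0, hid0, add_zero]) x
  have e2 := steinSolution_monotone_le m2 ((hneg.add hidi).congr
    (Eventually.of_forall fun t => (add_mul (-u t) t (φ t)).symm))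
    (by
      simp only [add_mul]
      rw [integral_add hneg hidi, hid0]
      simp only [neg_mul]
      rw [integral_neg, h0]; simp) x
  rw [steinSolution_add hint hidi, steinSolution_id] at e1
  rw [steinSolution_add hneg hidi, steinSolution_neg, steinSolution_id] at e2
  rw [abs_le]
  constructor <;> linarith

/-- Stein's method: the solution of the Stein equation for a `1`-Lipschitz test function, with its
classical bounds. -/
theorem exists_stein_solution {h : ℝ → ℝ} (hh : LipschitzWith 1 h) :
    ∃ f f' : ℝ → ℝ, (∀ x, HasDerivAt f (f' x) x) ∧
      (∀ x, f' x - x * f x = h x - ∫ t, h t ∂γ) ∧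
      (∀ x, |f' x| ≤ Real.sqrt (2 / Real.pi)) ∧ ∀ x y, |f' x - f' y| ≤ 2 * |x - y| := by
  set c := ∫ t, h t ∂γ
  set u : ℝ → ℝ := fun t => h t - c
  have hu : LipschitzWith 1 u := by
    refine LipschitzWith.of_dist_le_mul fun x y => ?_
    have := hh.dist_le_mul x y
    simpa [u, Real.dist_eq] using this
  have huγ : Integrable u γ :=
    integrable_stdGaussian_of_le_pow hu.continuous _ 1 hu.growth_le
  have hhγ : Integrable h γ :=
    integrable_stdGaussian_of_le_pow hh.continuous _ 1 hh.growth_le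
  have hint : Integrable fun t => u t * φ t := (integrable_stdGaussian_iff u).1 huγ
  have h0 : ∫ t, u t * φ t = 0 := by
    rw [← integral_stdGaussian u]
    simp only [u]
    rw [integral_sub hhγ (integrable_const c)]
    simp [c]
  set f := steinSolution u
  set f' : ℝ → ℝ := fun x => x * f x + u x
  have hf : ∀ x, HasDerivAt f (f' x) x := hasDerivAt_steinSolution hu.continuous hint
  have hfc : Continuous f := continuous_iff_continuousAt.2 fun z => (hf z).continuousAt
  have hy := abs_deriv_id_mul_steinSolution_le hu hint h0
  have hxf : ∀ x, HasDerivAt (fun x => x * f x) ((1 + x ^ 2) * f x + x * u x) x := fun x =>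
    ((hasDerivAt_id' x).fun_mul (hf x)).congr_deriv (by simp only [f']; ring)
  have hxfl : ∀ x y, |x * f x - y * f y| ≤ |x - y| := by
    intro x y
    have := Convex.norm_image_sub_le_of_norm_hasDerivWithin_le (s := univ) (C := 1)
      (fun z _ => (hxf z).hasDerivWithinAt) (fun z _ => hy z) convex_univ (mem_univ y) (mem_univ x)
    simpa using this
  -- Each of the two summands of `f' = x f + u` is 1-Lipschitz, whence the constant 2.
  have hf'l : ∀ x y, |f' x - f' y| ≤ 2 * |x - y| := by
    intro x y
    have h1 := abs_add_le (x * f x - y * f y) (u x - u y)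
    have h2 := hxfl x y
    have h3 := hu.abs_sub_le_real x y
    have e : f' x - f' y = (x * f x - y * f y) + (u x - u y) := by simp only [f']; ring
    rw [e]; linarith
  have hf'c : Continuous f' := (continuous_id.mul hfc).add hu.continuous
  refine ⟨f, f', hf, fun x => by simp only [f', u]; ring, ?_, hf'l⟩
  set K := 1 + |u 0|
  have hK : 1 ≤ K := by simp only [K]; linarith [abs_nonneg (u 0)]
  have gu : ∀ x, |u x| ≤ K * (1 + |x|) := fun x => by simpa using hu.growth_le x
  have gxf : ∀ x, |x * f x| ≤ |x| := fun x => by simpa using hxfl x 0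
  have gf : ∀ x, |f x| ≤ (2 * K) * (1 + |x|) ^ 2 := by
    intro x
    have h1 := hy x
    have h2 : |(1 + x ^ 2) * f x| ≤ 1 + |x| * |u x| := by
      have := abs_sub ((1 + x ^ 2) * f x + x * u x) (x * u x)
      rw [add_sub_cancel_right, abs_mul x] at this
      linarith
    rw [abs_mul, abs_of_nonneg (by positivity : 0 ≤ 1 + x ^ 2)] at h2
    have h3 : |f x| ≤ (1 + x ^ 2) * |f x| :=
      le_mul_of_one_le_left (abs_nonneg _) (by nlinarith [sq_nonneg x])
    have h4 := mul_le_mul_of_nonneg_left (gu x) (abs_nonneg x)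
    nlinarith [abs_nonneg x, mul_nonneg (by linarith : 0 ≤ K) (abs_nonneg x),
      mul_nonneg (by linarith : 0 ≤ K) (mul_nonneg (abs_nonneg x) (abs_nonneg x))]
  have gf' : ∀ x, |f' x| ≤ (2 * K) * (1 + |x|) ^ 2 := by
    intro x
    have h1 := abs_add_le (x * f x) (u x)
    have h2 := gxf x
    have h3 := gu x
    have : |f' x| ≤ |x| + K * (1 + |x|) := by simp only [f']; linarith
    nlinarith [abs_nonneg x, mul_nonneg (by linarith : 0 ≤ K) (abs_nonneg x),
      mul_nonneg (by linarith : 0 ≤ K) (mul_nonneg (abs_nonneg x) (abs_nonneg x))]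
  have hrep := stein_rotation_formula (u := u) hf hf'c (fun x => by simp only [f']; ring) gf gf'
  have hzu : ∀ x θ, Integrable (fun z => z * u (x * Real.cos θ + z * Real.sin θ)) γ := by
    intro x θ
    have huc := hu.continuous
    refine integrable_stdGaussian_of_le_pow (by fun_prop) (K * (1 + |x|)) 2 fun z => ?_
    have h1 := growth_rotation (C := K) (k := 1) (v := u) (fun z => by simpa using gu z) x θ z
    rw [abs_mul]
    have h2 := mul_le_mul_of_nonneg_left h1 (abs_nonneg z)
    refine h2.trans ?_
    have : 0 ≤ K * (1 + |x|) := by positivity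
    nlinarith [abs_nonneg z]
  have hcont : ∀ x, Continuous fun θ => ∫ z, z * u (x * Real.cos θ + z * Real.sin θ) ∂γ := by
    intro x
    have huc := hu.continuous
    refine MeasureTheory.continuous_of_dominated
      (bound := fun z => (K * (1 + |x|)) * (1 + |z|) ^ 2)
      (fun θ => Continuous.aestronglyMeasurable (by fun_prop))
      (fun θ => Eventually.of_forall fun z => ?_)
      ?_ (Eventually.of_forall fun z => by fun_prop)
    · have h1 := growth_rotation (C := K) (k := 1) (v := u) (fun z => by simpa using gu z) x θ z
      rw [norm_mul, Real.norm_eq_abs, Real.norm_eq_abs]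
      have h2 := mul_le_mul_of_nonneg_left h1 (abs_nonneg z)
      refine h2.trans ?_
      have : 0 ≤ K * (1 + |x|) := by positivity
      nlinarith [abs_nonneg z]
    · refine integrable_stdGaussian_of_le_pow (by fun_prop) (K * (1 + |x|)) 2 fun z => ?_
      rw [abs_of_nonneg (by positivity)]
  set E := Real.sqrt (2 / Real.pi)
  have habs : Integrable (fun z : ℝ => |z|) γ :=
    integrable_stdGaussian_of_le_pow continuous_abs 1 1 fun z => by simp
  -- In the rotation formula `u` is Lipschitz in `x` with factor `cos θ`. The constant is therefore
  -- `E|Z|` times the integral of `cos` over `[0, π/2]`, which is 1.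
  have hlip : ∀ x y, |f x - f y| ≤ E * |x - y| := by
    intro x y
    rw [hrep x, hrep y, neg_sub_neg, ← intervalIntegral.integral_sub
      ((hcont y).intervalIntegrable _ _) ((hcont x).intervalIntegrable _ _)]
    have hb : ∀ θ ∈ Icc 0 (Real.pi / 2), ‖(∫ z, z * u (y * Real.cos θ + z * Real.sin θ) ∂γ) -
        ∫ z, z * u (x * Real.cos θ + z * Real.sin θ) ∂γ‖ ≤ E * |x - y| * Real.cos θ := by
      intro θ hθ
      have hcos : 0 ≤ Real.cos θ :=
        Real.cos_nonneg_of_mem_Icc ⟨by linarith [hθ.1, Real.pi_pos], hθ.2⟩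
      rw [← integral_sub (hzu y θ) (hzu x θ)]
      refine (norm_integral_le_of_norm_le (habs.mul_const (|x - y| * Real.cos θ))
        (Eventually.of_forall fun z => ?_)).trans_eq ?_
      · rw [← mul_sub, norm_mul, Real.norm_eq_abs]
        refine mul_le_mul_of_nonneg_left ((hu.abs_sub_le_real _ _).trans_eq ?_) (abs_nonneg z)
        rw [add_sub_add_right_eq_sub, ← sub_mul, abs_mul, abs_of_nonneg hcos, abs_sub_comm]
      · rw [integral_mul_const, integral_abs_stdGaussian]; ring
    have hpi : (0 : ℝ) ≤ Real.pi / 2 := by positivity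
    refine (intervalIntegral.norm_integral_le_of_norm_le hpi
      (Eventually.of_forall fun θ hθ => hb θ ⟨hθ.1.le, hθ.2⟩)
      (Continuous.intervalIntegrable (by fun_prop) _ _)).trans_eq ?_
    rw [intervalIntegral.integral_const_mul, integral_cos]
    simp
  intro x
  have hE : 0 ≤ E := Real.sqrt_nonneg _
  have := (hf x).le_of_lipschitz (C := ⟨E, hE⟩)
    (LipschitzWith.of_dist_le_mul fun a b => by
      rw [Real.dist_eq, Real.dist_eq]; exact hlip a b)
  exact this

end SteinBounds

/-! ### Counting allocations: negative dependence of overflows. -/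

section Allocations

open Finset

/-- The number of balls in urn `j` under the allocation `a`. -/
def occupancy {n m : ℕ} (a : Fin n → Fin m) (j : Fin m) : ℕ := #{i | a i = j}

/-- The overflow of an urn that receives `c` balls. -/
noncomputable def cellOverflow (k c : ℕ) : ℝ := if k ≤ c then (c : ℝ) - k + 1 else 0

/-- The total overflow of an occupancy vector. -/
noncomputable def vectorOverflow {m : ℕ} (k : ℕ) (c : Fin m → ℕ) : ℝ :=
  ∑ j, cellOverflow k (c j)

lemma cellOverflow_nonneg (k c : ℕ) : 0 ≤ cellOverflow k c := by
  unfold cellOverflow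
  split_ifs with h
  · have : (k : ℝ) ≤ c := by exact_mod_cast h
    linarith
  · exact le_rfl

lemma cellOverflow_le_succ (k c : ℕ) : cellOverflow k c ≤ cellOverflow k (c + 1) := by
  unfold cellOverflow
  split_ifs with h h' h'
  · push_cast; linarith
  · omega
  · have : (k : ℝ) ≤ (c + 1 : ℕ) := by exact_mod_cast h'
    linarith
  · exact le_rfl

lemma cellOverflow_succ_le (k c : ℕ) : cellOverflow k (c + 1) ≤ cellOverflow k c + 1 := by
  unfold cellOverflow
  split_ifs with h h' h'
  · push_cast; linarith
  · have : (k : ℝ) = (c + 1 : ℕ) := by exact_mod_cast (by omega : k = c + 1)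
    linarith
  · omega
  · linarith

lemma vectorOverflow_update_le {m : ℕ} (k : ℕ) (c : Fin m → ℕ) (v : Fin m) :
    vectorOverflow k c ≤ vectorOverflow k (c + Pi.single v 1) := by
  refine sum_le_sum fun j _ => ?_
  by_cases h : j = v
  · subst h; simpa using cellOverflow_le_succ k (c j)
  · simp [h]

lemma vectorOverflow_le_update {m : ℕ} (k : ℕ) (c : Fin m → ℕ) (v : Fin m) :
    vectorOverflow k (c + Pi.single v 1) ≤ vectorOverflow k c + 1 := by
  have h1 : ∀ j, cellOverflow k ((c + Pi.single v 1 : Fin m → ℕ) j) ≤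
      cellOverflow k (c j) + if j = v then 1 else 0 := by
    intro j
    by_cases h : j = v
    · subst h; simpa using cellOverflow_succ_le k (c j)
    · simp [h]
  refine (sum_le_sum fun j _ => h1 j).trans_eq ?_
  rw [sum_add_distrib]
  simp [vectorOverflow]

lemma occupancy_cons {n m : ℕ} (u : Fin m) (a : Fin n → Fin m) :
    occupancy (Fin.cons u a : Fin (n + 1) → Fin m) = occupancy a + Pi.single u 1 := by
  funext j
  simp only [occupancy, card_filter, Fin.sum_univ_succ, Fin.cons_zero, Fin.cons_succ, Pi.add_apply]
  rw [add_comm, Pi.single_apply]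
  simp [eq_comm]

lemma sum_allocation_succ {n m : ℕ} (F : (Fin m → ℕ) → ℝ) :
    ∑ a : Fin (n + 1) → Fin m, F (occupancy a) =
      ∑ v : Fin m, ∑ a : Fin n → Fin m, F (occupancy a + Pi.single v 1) := by
  rw [← (Fin.consEquiv fun _ => Fin m).sum_comp, Fintype.sum_prod_type]
  refine sum_congr rfl fun v _ => sum_congr rfl fun a _ => ?_
  rw [← occupancy_cons]
  rfl

/-- Conditioning on the number of balls in the first urn. -/
lemma sum_allocation_eq_sum_antidiagonal {M : ℕ} (n : ℕ) (F : ℕ → (Fin M → ℕ) → ℝ) :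
    ∑ a : Fin n → Fin (M + 1), F (occupancy a 0) (fun j => occupancy a j.succ) =
      ∑ ij ∈ antidiagonal n, n.choose ij.1 • ∑ b : Fin ij.2 → Fin M, F ij.1 (occupancy b) := by
  induction n generalizing F with
  | zero =>
    simp only [Nat.antidiagonal_zero, sum_singleton, Nat.choose_self, one_smul]
    rw [Fintype.sum_unique, Fintype.sum_unique]
    congr 1
  | succ n ih =>
    -- Pascal's rule matches the choice for one ball: it lands in urn 0 or in one of the other `M`
    -- urns.
    rw [sum_allocation_succ (fun c : Fin (M + 1) → ℕ => F (c 0) fun j => c j.succ),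
      Fin.sum_univ_succ, sum_antidiagonal_choose_succ_nsmul
        (fun i j => ∑ b : Fin j → Fin M, F i (occupancy b)) n, add_comm]
    congr 1
    · have h := ih fun i c => ∑ v : Fin M, F i (c + Pi.single v 1)
      rw [sum_comm]
      convert h using 1
      · refine sum_congr rfl fun a _ => sum_congr rfl fun v _ => ?_
        congr 1
        funext j
        simp [Pi.single_apply]
      · refine sum_congr rfl fun ij _ => ?_
        rw [sum_allocation_succ, sum_comm]
    · have h := ih fun i c => F (i + 1) c
      convert h using 1
      · refine sum_congr rfl fun a _ => ?_
        congr 1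
      · refine sum_congr rfl fun ij hij => ?_
        rw [Nat.choose_symm_of_eq_add (mem_antidiagonal.1 hij).symm]

/-- The mean of `φ` of the total overflow when `N` balls are allocated uniformly to `M` urns. -/
noncomputable def meanOverflow (k M N : ℕ) (φ : ℝ → ℝ) : ℝ :=
  (∑ b : Fin N → Fin M, φ (vectorOverflow k (occupancy b))) / (M : ℝ) ^ N

lemma meanOverflow_succ (k M N : ℕ) (φ : ℝ → ℝ) :
    meanOverflow k M (N + 1) φ = (∑ v : Fin M, ∑ b : Fin N → Fin M,
      φ (vectorOverflow k (occupancy b + Pi.single v 1))) / (M : ℝ) ^ (N + 1) := by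
  rw [meanOverflow, sum_allocation_succ fun c => φ (vectorOverflow k c)]

/-- Coupling: an allocation of `N + 1` balls is one of `N` balls plus a ball in a uniform urn, which
never lowers the overflow. -/
lemma meanOverflow_le_succ {k M N : ℕ} (hM : 0 < M) {φ : ℝ → ℝ} (hφ : Monotone φ) :
    meanOverflow k M N φ ≤ meanOverflow k M (N + 1) φ := by
  have hM' : (0 : ℝ) < M := by exact_mod_cast hM
  rw [meanOverflow_succ, meanOverflow, div_le_div_iff₀ (by positivity) (by positivity), pow_succ,
    ← mul_assoc, mul_right_comm]
  refine mul_le_mul_of_nonneg_right ?_ (by positivity)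
  have : ∑ _v : Fin M, ∑ b : Fin N → Fin M, φ (vectorOverflow k (occupancy b)) ≤
      ∑ v : Fin M, ∑ b : Fin N → Fin M, φ (vectorOverflow k (occupancy b + Pi.single v 1)) :=
    sum_le_sum fun v _ => sum_le_sum fun b _ => hφ (vectorOverflow_update_le k _ v)
  simp only [sum_const, card_univ, Fintype.card_fin, nsmul_eq_mul] at this
  linarith

lemma meanOverflow_succ_le {k M N : ℕ} (hM : 0 < M) {φ : ℝ → ℝ} (hφ : Monotone φ) :
    meanOverflow k M (N + 1) φ ≤ meanOverflow k M N fun x => φ (x + 1) := by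
  have hM' : (0 : ℝ) < M := by exact_mod_cast hM
  rw [meanOverflow_succ, meanOverflow, div_le_div_iff₀ (by positivity) (by positivity), pow_succ,
    ← mul_assoc, mul_right_comm]
  refine mul_le_mul_of_nonneg_right ?_ (by positivity)
  have : ∑ v : Fin M, ∑ b : Fin N → Fin M, φ (vectorOverflow k (occupancy b + Pi.single v 1)) ≤
      ∑ _v : Fin M, ∑ b : Fin N → Fin M, φ (vectorOverflow k (occupancy b) + 1) :=
    sum_le_sum fun v _ => sum_le_sum fun b _ => hφ (vectorOverflow_le_update k _ v)
  simp only [sum_const, card_univ, Fintype.card_fin, nsmul_eq_mul] at this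
  linarith

lemma meanOverflow_mono {k M : ℕ} (hM : 0 < M) {φ : ℝ → ℝ} (hφ : Monotone φ) :
    Monotone fun N => meanOverflow k M N φ :=
  monotone_nat_of_le_succ fun _ => meanOverflow_le_succ hM hφ

lemma meanOverflow_add_le {k M : ℕ} (hM : 0 < M) (N d : ℕ) {φ : ℝ → ℝ} (hφ : Monotone φ) :
    meanOverflow k M (N + d) φ ≤ meanOverflow k M N fun x => φ (x + d) := by
  induction d generalizing φ with
  | zero => simp
  | succ d ih =>
    refine (meanOverflow_succ_le (N := N + d) hM hφ).trans
      ((ih fun a b h => hφ (by linarith)).trans_eq ?_)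
    push_cast
    simp only [add_assoc]

lemma meanOverflow_le_of_le {k M : ℕ} (hM : 0 < M) (N : ℕ) {φ ψ : ℝ → ℝ} (h : ∀ x, φ x ≤ ψ x) :
    meanOverflow k M N φ ≤ meanOverflow k M N ψ := by
  unfold meanOverflow
  gcongr
  exact h _

/-- The overflow of the other urns, given that the first urn receives at least `k` balls, is
dominated by an unconditional total overflow. -/
lemma meanOverflow_le_of_add_eq {k M i j i' j' : ℕ} (hM : 0 < M) (hi : k ≤ i)
    (h : i + j = i' + j') {φ : ℝ → ℝ} (hφ : Monotone φ) :
    meanOverflow k M j φ ≤ meanOverflow k M j' fun x => φ (x + cellOverflow k i') := by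
  rcases le_total j j' with hj | hj
  · refine (meanOverflow_mono hM hφ hj).trans (meanOverflow_le_of_le hM _ fun x => hφ ?_)
    linarith [cellOverflow_nonneg k i']
  · obtain ⟨d, rfl⟩ := Nat.exists_eq_add_of_le hj
    refine (meanOverflow_add_le hM j' d hφ).trans (meanOverflow_le_of_le hM _ fun x => hφ ?_)
    have h2 : i' = i + d := by omega
    -- The `d` surplus balls outside cost at most `d`, while urn 0 with `i + d` balls, `i ≥ k`,
    -- already overflows by at least `d + 1`.
    have h3 : (k : ℝ) ≤ i := by exact_mod_cast hi
    rw [cellOverflow, if_pos (by omega), h2]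
    push_cast
    linarith

lemma vectorOverflow_succ {M : ℕ} (k : ℕ) (c : Fin (M + 1) → ℕ) :
    vectorOverflow k c = cellOverflow k (c 0) + vectorOverflow k fun j => c j.succ := by
  simp [vectorOverflow, Fin.sum_univ_succ]

lemma sum_choose_mul_pow_antidiagonal (n M : ℕ) :
    ∑ ij ∈ antidiagonal n, (n.choose ij.1 : ℝ) * (M : ℝ) ^ ij.2 = ((M : ℝ) + 1) ^ n := by
  have := (Commute.all (1 : ℝ) (M : ℝ)).add_pow' n
  simp only [one_pow, one_mul, nsmul_eq_mul] at this
  rw [add_comm, this]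

/-- The pointwise comparison is averaged over the binomial number of balls in urn 0 of an
unconditioned allocation, with weights `n.choose i' * M ^ j'` summing to `(M + 1) ^ n`. -/
lemma meanOverflow_le_mean {k M n i j : ℕ} (hM : 0 < M) (hi : k ≤ i) (h : i + j = n)
    {φ : ℝ → ℝ} (hφ : Monotone φ) :
    ((M : ℝ) + 1) ^ n * meanOverflow k M j φ ≤
      ∑ a : Fin n → Fin (M + 1), φ (vectorOverflow k (occupancy a)) := by
  have hM' : (0 : ℝ) < M := by exact_mod_cast hM
  have e := sum_allocation_eq_sum_antidiagonal n
    fun i' (c : Fin M → ℕ) => φ (cellOverflow k i' + vectorOverflow k c)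
  simp only [← vectorOverflow_succ] at e
  rw [e, ← sum_choose_mul_pow_antidiagonal, sum_mul]
  refine sum_le_sum fun ij hij => ?_
  rw [nsmul_eq_mul, mul_assoc]
  refine mul_le_mul_of_nonneg_left ?_ (Nat.cast_nonneg _)
  have := meanOverflow_le_of_add_eq hM hi (h.trans (mem_antidiagonal.1 hij).symm) hφ
  refine (mul_le_mul_of_nonneg_left this (by positivity)).trans_eq ?_
  rw [meanOverflow, mul_div_cancel₀ _ (by positivity)]
  simp only [add_comm]

/-- Negative dependence: for increasing `φ`, the size-biased total overflow is dominated by the sum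
of an independent copy of the total overflow and the size-biased overflow of a single urn. -/
theorem sum_overflow_mul_le {k M n : ℕ} (hM : 0 < M) {φ : ℝ → ℝ} (hφ : Monotone φ) :
    ((M : ℝ) + 1) ^ n * ∑ a : Fin n → Fin (M + 1),
        cellOverflow k (occupancy a 0) * φ (vectorOverflow k (occupancy a)) ≤
      ∑ a : Fin n → Fin (M + 1), ∑ b : Fin n → Fin (M + 1),
        cellOverflow k (occupancy a 0) *
          φ (vectorOverflow k (occupancy b) + cellOverflow k (occupancy a 0)) := by
  have hM' : (0 : ℝ) < M := by exact_mod_cast hM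
  have e1 := sum_allocation_eq_sum_antidiagonal n fun i (c : Fin M → ℕ) =>
    cellOverflow k i * φ (cellOverflow k i + vectorOverflow k c)
  simp only [← vectorOverflow_succ] at e1
  have e2 := sum_allocation_eq_sum_antidiagonal n fun i (_ : Fin M → ℕ) =>
    ∑ b : Fin n → Fin (M + 1), cellOverflow k i * φ (vectorOverflow k (occupancy b) +
      cellOverflow k i)
  rw [e1, e2, mul_sum]
  refine sum_le_sum fun ij hij => ?_
  rw [nsmul_eq_mul, nsmul_eq_mul, mul_left_comm]
  refine mul_le_mul_of_nonneg_left ?_ (Nat.cast_nonneg _)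
  rw [← mul_sum, ← mul_sum, mul_left_comm, sum_const, nsmul_eq_mul, mul_left_comm _ (cellOverflow k _)]
  -- The weight `cellOverflow` vanishes when urn 0 has fewer than `k` balls, so the comparison is
  -- needed only from level `k` on.
  by_cases hk : k ≤ ij.1
  · refine mul_le_mul_of_nonneg_left ?_ (cellOverflow_nonneg _ _)
    have := meanOverflow_le_mean hM hk (mem_antidiagonal.1 hij)
      (φ := fun x => φ (x + cellOverflow k ij.1)) fun a b h => hφ (by linarith)
    have h2 := mul_le_mul_of_nonneg_left this (by positivity : 0 ≤ (M : ℝ) ^ ij.2)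
    rw [mul_left_comm, meanOverflow, mul_div_cancel₀ _ (by positivity)] at h2
    simpa [add_comm] using h2
  · simp [cellOverflow, hk]

end Allocations

/-! ### Averages over a finite type. -/

section UniformAverage

variable {A : Type*} [Fintype A]

/-- The mean of `F` under the uniform law on a finite type. -/
noncomputable def uniformMean (F : A → ℝ) : ℝ := (∑ a, F a) / Fintype.card A

lemma uniformMean_add (F G : A → ℝ) :
    uniformMean (fun a => F a + G a) = uniformMean F + uniformMean G := by
  simp [uniformMean, Finset.sum_add_distrib, add_div]

lemma uniformMean_sub (F G : A → ℝ) :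
    uniformMean (fun a => F a - G a) = uniformMean F - uniformMean G := by
  simp [uniformMean, Finset.sum_sub_distrib, sub_div]

lemma uniformMean_const_mul (c : ℝ) (F : A → ℝ) :
    uniformMean (fun a => c * F a) = c * uniformMean F := by
  simp [uniformMean, ← Finset.mul_sum, mul_div_assoc]

lemma uniformMean_const [Nonempty A] (c : ℝ) : uniformMean (fun _ : A => c) = c := by
  simp [uniformMean]

lemma uniformMean_mono {F G : A → ℝ} (h : ∀ a, F a ≤ G a) : uniformMean F ≤ uniformMean G := by
  unfold uniformMean
  gcongr
  exact h _

lemma abs_uniformMean_le {F G : A → ℝ} (h : ∀ a, |F a| ≤ G a) : |uniformMean F| ≤ uniformMean G := by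
  rw [abs_le]
  constructor
  · have := uniformMean_mono fun a => (abs_le.1 (h a)).1
    have e := uniformMean_const_mul (-1) G
    simp only [neg_mul, one_mul] at e
    linarith
  · exact uniformMean_mono fun a => (abs_le.1 (h a)).2

end UniformAverage

/-! ### The abstract normal approximation bound. -/

section SteinFinite

/-- Second order Taylor bound for a function with Lipschitz derivative. -/
lemma abs_taylor_le {g g' : ℝ → ℝ} (hg : ∀ x, HasDerivAt g (g' x) x) {l : ℝ}
    (hl : ∀ x y, |g' x - g' y| ≤ l * |x - y|) (w : ℝ) {y : ℝ} (hy : 0 ≤ y) :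
    |g (w + y) - g w - y * g' w| ≤ l * y ^ 2 / 2 := by
  have hd : ∀ s, HasDerivAt (fun s => g (w + s) - g w - s * g' w) (g' (w + s) - g' w) s := by
    intro s
    have h1 : HasDerivAt (fun s => w + s) 1 s := (hasDerivAt_id' s).const_add w
    exact ((((hg (w + s)).comp s h1).sub_const (g w)).fun_sub
      ((hasDerivAt_id' s).mul_const (g' w))).congr_deriv (by ring)
  have hB : ∀ s, HasDerivAt (fun s : ℝ => l * s ^ 2 / 2) (l * s) s := fun s =>
    (((hasDerivAt_pow 2 s).const_mul l).div_const 2).congr_deriv (by norm_num; ring)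
  have := image_norm_le_of_norm_deriv_right_le_deriv_boundary (a := 0) (b := y)
    (fun s _ => (hd s).continuousAt.continuousWithinAt)
    (fun s _ => (hd s).hasDerivWithinAt) (by simp) hB
    (fun s hs => by
      have h := hl (w + s) w
      rwa [add_sub_cancel_left, abs_of_nonneg hs.1] at h)
    ⟨hy, le_rfl⟩
  simpa using this

/-- A normal approximation bound for a nonnegative sum `W` whose size-biased version is dominated by
`W` plus an independent variable. -/
theorem stein_bound_of_size_bias {A : Type*} [Fintype A] [Nonempty A] {Y W : A → ℝ} {m σ : ℝ}
    (hm : 0 < m) (hY : ∀ a, 0 ≤ Y a)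
    (hbias : ∀ g : ℝ → ℝ, uniformMean (fun a => W a * g (W a)) =
      m * uniformMean fun a => Y a * g (W a))
    (hdom : ∀ φ : ℝ → ℝ, Monotone φ → uniformMean (fun a => Y a * φ (W a)) ≤
      uniformMean fun a => uniformMean fun b => Y a * φ (W b + Y a))
    (hσ : 0 < σ) (hvar : σ ^ 2 = uniformMean (fun a => W a ^ 2) - uniformMean W ^ 2)
    {h : ℝ → ℝ} (hh : LipschitzWith 1 h) :
    |uniformMean (fun a => h ((W a - uniformMean W) / σ)) - ∫ x, h x ∂gaussianReal 0 1| ≤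
      uniformMean (fun a => Y a ^ 3) / (σ * uniformMean fun a => Y a ^ 2) +
        Real.sqrt (8 / Real.pi) * m * (σ ^ 2)⁻¹ *
          (m * uniformMean Y ^ 2 + uniformMean (fun a => Y a ^ 2) -
            uniformMean fun a => Y a * W a) := by
  obtain ⟨f, f', hf, hstein, hf'b, hf'l⟩ := exists_stein_solution hh
  set N := ∫ x, h x ∂gaussianReal 0 1
  set L := Real.sqrt (2 / Real.pi)
  set μ := uniformMean W with hμ
  set e := uniformMean Y with he
  set s2 := uniformMean (fun a => Y a ^ 2) with hs2
  set s3 := uniformMean (fun a => Y a ^ 3) with hs3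
  have hL : 0 ≤ L := Real.sqrt_nonneg _
  have h8 : Real.sqrt (8 / Real.pi) = 2 * L := by
    rw [show (8 : ℝ) / Real.pi = 2 ^ 2 * (2 / Real.pi) by ring, Real.sqrt_mul (by positivity),
      Real.sqrt_sq (by norm_num)]
  set g : ℝ → ℝ := fun w => f ((w - μ) / σ)
  set g' : ℝ → ℝ := fun w => f' ((w - μ) / σ) / σ
  have hg : ∀ w, HasDerivAt g (g' w) w := by
    intro w
    have h1 : HasDerivAt (fun w => (w - μ) / σ) (1 / σ) w :=
      ((hasDerivAt_id' w).sub_const μ).div_const σ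
    exact ((hf _).comp w h1).congr_deriv (by simp only [g']; ring)
  have hg'b : ∀ w, |g' w| ≤ L / σ := by
    intro w
    simp only [g']
    rw [abs_div, abs_of_pos hσ]
    gcongr
    exact hf'b _
  have hg'l : ∀ x y, |g' x - g' y| ≤ 2 / σ ^ 2 * |x - y| := by
    intro x y
    have h1 := hf'l ((x - μ) / σ) ((y - μ) / σ)
    have e1 : (x - μ) / σ - (y - μ) / σ = (x - y) / σ := by ring
    rw [e1, abs_div, abs_of_pos hσ] at h1
    simp only [g']
    rw [← sub_div, abs_div, abs_of_pos hσ, div_le_iff₀ hσ]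
    refine h1.trans_eq ?_
    field_simp
  have hgl : ∀ x y, |g x - g y| ≤ L / σ * |x - y| := by
    intro x y
    have := Convex.norm_image_sub_le_of_norm_hasDerivWithin_le (s := Set.univ) (C := L / σ)
      (fun z _ => (hg z).hasDerivWithinAt) (fun z _ => hg'b z) convex_univ (Set.mem_univ y)
      (Set.mem_univ x)
    simpa using this
  -- Adding `L/σ` times the identity makes `±g` increasing. Only `ε = ±1` is used, giving both sides
  -- of the bound on `Q - R`.
  have hmono : ∀ ε : ℝ, |ε| ≤ 1 → Monotone fun x => L / σ * x + ε * g x := by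
    intro ε hε x y hxy
    have h1 : |ε * (g x - g y)| ≤ L / σ * |x - y| := by
      rw [abs_mul]
      exact (mul_le_of_le_one_left (abs_nonneg _) hε).trans (hgl x y)
    have := (abs_le.1 h1).2
    rw [abs_of_nonpos (by linarith : x - y ≤ 0)] at this
    simp only; linarith
  have hμe : μ = m * e := by simpa using hbias fun _ => 1
  have hWW : uniformMean (fun a => W a ^ 2) = m * uniformMean fun a => Y a * W a := by
    simpa [sq] using hbias fun x => x
  set q := uniformMean fun a => Y a * W a with hq
  set δ := m * e ^ 2 + s2 - q with hδ
  have hvar' : σ ^ 2 = m * s2 - m * δ := by rw [hvar, hWW, hμe, hδ]; ring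
  set c := uniformMean fun a => g' (W a) with hc
  set G := uniformMean fun a => g (W a) with hG
  set R := uniformMean fun a => Y a * g (W a) with hR
  set Q := uniformMean fun a => uniformMean fun b => Y a * g (W b + Y a) with hQ
  have hlin : (uniformMean fun a => uniformMean fun b => Y a * (W b + Y a)) = m * e ^ 2 + s2 := by
    have h1 : ∀ a, (uniformMean fun b => Y a * (W b + Y a)) = μ * Y a + Y a ^ 2 := by
      intro a
      rw [uniformMean_const_mul, uniformMean_add, uniformMean_const]
      ring
    simp only [h1]
    rw [uniformMean_add, uniformMean_const_mul, hμe]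
    ring
  -- The quantity `δ` is the gap in the domination hypothesis for the identity.
  have hδ0 : 0 ≤ δ := by
    have := hdom (fun x => x) monotone_id
    rw [hlin] at this
    linarith
  have hs2pos : 0 < s2 := by
    have h1 : 0 < m * s2 := by
      have := mul_nonneg hm.le hδ0
      have := pow_pos hσ 2
      linarith
    exact pos_of_mul_pos_right h1 hm.le
  have hD' : ∀ ε : ℝ, |ε| ≤ 1 → L / σ * q + ε * R ≤ L / σ * (m * e ^ 2 + s2) + ε * Q := by
    intro ε hε
    have h1 := hdom _ (hmono ε hε)
    have e1 : (fun a => Y a * (L / σ * W a + ε * g (W a))) =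
        fun a => L / σ * (Y a * W a) + ε * (Y a * g (W a)) := by funext a; ring
    have e2 : (fun a => uniformMean fun b => Y a * (L / σ * (W b + Y a) + ε * g (W b + Y a))) =
        fun a => L / σ * (uniformMean fun b => Y a * (W b + Y a)) +
          ε * uniformMean fun b => Y a * g (W b + Y a) := by
      funext a
      rw [← uniformMean_const_mul, ← uniformMean_const_mul, ← uniformMean_add]
      congr 1; funext b; ring
    rw [e1, e2, uniformMean_add, uniformMean_add, uniformMean_const_mul, uniformMean_const_mul,
      uniformMean_const_mul, uniformMean_const_mul, hlin] at h1
    exact h1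
  have hD : |Q - R| ≤ L / σ * δ := by
    rw [abs_le, hδ]
    have h1 := hD' 1 (by simp)
    have h2 := hD' (-1) (by simp)
    constructor <;> linarith
  have hTeq : m * Q - m * e * G = uniformMean fun a => uniformMean fun b =>
      m * (Y a * (g (W b + Y a) - g (W b))) := by
    have h1 : ∀ a, (uniformMean fun b => m * (Y a * (g (W b + Y a) - g (W b)))) =
        m * (uniformMean fun b => Y a * g (W b + Y a)) - m * G * Y a := by
      intro a
      simp only [uniformMean_const_mul, uniformMean_sub]
      ring
    simp only [h1]
    rw [uniformMean_sub, uniformMean_const_mul, uniformMean_const_mul]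
    ring
  have hT : |m * Q - m * e * G| ≤ m * s2 * (L / σ) := by
    rw [hTeq]
    refine (abs_uniformMean_le (G := fun a => m * (L / σ) * Y a ^ 2) fun a => ?_).trans_eq ?_
    · refine (abs_uniformMean_le (G := fun b => m * (L / σ) * Y a ^ 2) fun b => ?_).trans_eq
        (uniformMean_const _)
      rw [abs_mul, abs_mul, abs_of_pos hm, abs_of_nonneg (hY a)]
      have h1 := hgl (W b + Y a) (W b)
      rw [add_sub_cancel_left, abs_of_nonneg (hY a)] at h1
      calc m * (Y a * |g (W b + Y a) - g (W b)|) ≤ m * (Y a * (L / σ * Y a)) := by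
            gcongr
            exact hY a
        _ = _ := by ring
    · rw [uniformMean_const_mul]; ring
  have hTc : |m * Q - m * e * G - m * s2 * c| ≤ m * s3 * (2 / σ ^ 2 / 2) := by
    have h1 : m * Q - m * e * G - m * s2 * c = uniformMean fun a => uniformMean fun b =>
        m * (Y a * (g (W b + Y a) - g (W b) - Y a * g' (W b))) := by
      have h2 : ∀ a, (uniformMean fun b => m * (Y a * (g (W b + Y a) - g (W b) - Y a * g' (W b)))) =
          (uniformMean fun b => m * (Y a * (g (W b + Y a) - g (W b)))) - m * c * Y a ^ 2 := by
        intro a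
        simp only [uniformMean_const_mul, uniformMean_sub]
        ring
      simp only [h2]
      rw [uniformMean_sub, uniformMean_const_mul, hTeq]
      ring
    rw [h1]
    refine (abs_uniformMean_le (G := fun a => m * (2 / σ ^ 2 / 2) * Y a ^ 3) fun a => ?_).trans_eq ?_
    · refine (abs_uniformMean_le (G := fun b => m * (2 / σ ^ 2 / 2) * Y a ^ 3) fun b => ?_).trans_eq
        (uniformMean_const _)
      rw [abs_mul, abs_mul, abs_of_pos hm, abs_of_nonneg (hY a)]
      have h3 := abs_taylor_le hg hg'l (W b) (hY a)
      calc _ ≤ m * (Y a * (2 / σ ^ 2 * Y a ^ 2 / 2)) := by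
            gcongr
            exact hY a
        _ = _ := by ring
    · rw [uniformMean_const_mul]; ring
  -- This is the Stein equation at `(W - μ)/σ`, averaged, with `E[W g(W)] = m R` and `Q` inserted as
  -- intermediate term.
  have hmain : uniformMean (fun a => h ((W a - μ) / σ)) - N =
      σ * c - σ⁻¹ * ((m * Q - m * e * G) - m * (Q - R)) := by
    have h1 : (fun a => h ((W a - μ) / σ)) =
        fun a => N + (σ * g' (W a) - σ⁻¹ * (W a * g (W a) - μ * g (W a))) := by
      funext a
      have := hstein ((W a - μ) / σ)
      simp only [g, g']
      field_simp
      field_simp at this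
      linarith
    rw [h1, uniformMean_add, uniformMean_const, uniformMean_sub, uniformMean_const_mul,
      uniformMean_const_mul, uniformMean_sub, uniformMean_const_mul, hbias, hμe]
    ring
  rw [hmain, h8]
  set T := m * Q - m * e * G
  have hms : 0 < m * s2 := by positivity
  -- Since `σ² = m s2 - m δ`, the weights `σ²/(m s2)` and `δ/s2` sum to 1. Splitting `T` accordingly
  -- scales the Taylor error down to `s3/(σ s2)`. The part `δ/s2 · T` and the term `m (Q - R)` each
  -- contribute `L m δ/σ²`, hence `2L = √(8/π)`.
  have key : σ * c - σ⁻¹ * (T - m * (Q - R)) =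
      σ⁻¹ * (-(σ ^ 2 / (m * s2) * (T - m * s2 * c)) - δ / s2 * T + m * (Q - R)) := by
    have : δ = (m * s2 - σ ^ 2) / m := by rw [hvar']; field_simp; ring
    rw [this]
    field_simp
    ring
  rw [key, abs_mul, abs_of_pos (inv_pos.2 hσ)]
  have b1 : |σ ^ 2 / (m * s2) * (T - m * s2 * c)| ≤ σ ^ 2 / (m * s2) * (m * s3 * (2 / σ ^ 2 / 2)) := by
    rw [abs_mul, abs_of_pos (by positivity)]
    exact mul_le_mul_of_nonneg_left hTc (by positivity)
  have b2 : |δ / s2 * T| ≤ δ / s2 * (m * s2 * (L / σ)) := by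
    rw [abs_mul, abs_of_nonneg (by positivity)]
    exact mul_le_mul_of_nonneg_left hT (by positivity)
  have b3 : |m * (Q - R)| ≤ m * (L / σ * δ) := by
    rw [abs_mul, abs_of_pos hm]
    exact mul_le_mul_of_nonneg_left hD hm.le
  have b4 : |-(σ ^ 2 / (m * s2) * (T - m * s2 * c)) - δ / s2 * T + m * (Q - R)| ≤
      σ ^ 2 / (m * s2) * (m * s3 * (2 / σ ^ 2 / 2)) + δ / s2 * (m * s2 * (L / σ)) +
        m * (L / σ * δ) := by
    refine (abs_add_le _ _).trans (add_le_add ((abs_sub _ _).trans (add_le_add ?_ b2)) b3)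
    rwa [abs_neg]
  refine (mul_le_mul_of_nonneg_left b4 (inv_pos.2 hσ).le).trans_eq ?_
  field_simp
  ring

end SteinFinite

/-! ### Symmetry of the urns. -/

section Exchangeability

lemma occupancy_comp_perm {n m : ℕ} (π : Equiv.Perm (Fin m)) (a : Fin n → Fin m) (j : Fin m) :
    occupancy (fun i => π.symm (a i)) j = occupancy a (π j) := by
  simp [occupancy, Equiv.symm_apply_eq]

lemma uniformMean_perm {n m : ℕ} (π : Equiv.Perm (Fin m)) (F : (Fin m → ℕ) → ℝ) :
    (uniformMean fun a : Fin n → Fin m => F (occupancy a)) =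
      uniformMean fun a : Fin n → Fin m => F fun j => occupancy a (π j) := by
  unfold uniformMean
  congr 1
  rw [← (Equiv.arrowCongr (Equiv.refl (Fin n)) π.symm).sum_comp]
  refine Finset.sum_congr rfl fun a _ => ?_
  congr 1
  funext j
  exact occupancy_comp_perm π a j

lemma vectorOverflow_perm {m : ℕ} (k : ℕ) (π : Equiv.Perm (Fin m)) (c : Fin m → ℕ) :
    vectorOverflow k (fun j => c (π j)) = vectorOverflow k c :=
  Equiv.sum_comp π fun j => cellOverflow k (c j)

lemma uniformMean_sum {A ι : Type*} [Fintype A] [Fintype ι] (F : ι → A → ℝ) :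
    uniformMean (fun a => ∑ i, F i a) = ∑ i, uniformMean (F i) := by
  simp only [uniformMean, ← Finset.sum_div]
  rw [Finset.sum_comm]

/-- Expanding the total overflow over urns gives `M + 1` equal terms, since swapping urn `j` with
urn 0 leaves the total unchanged. -/
lemma uniformMean_overflow_mul {n M : ℕ} (k : ℕ) (g : ℝ → ℝ) :
    (uniformMean fun a : Fin n → Fin (M + 1) =>
      vectorOverflow k (occupancy a) * g (vectorOverflow k (occupancy a))) =
    ((M : ℝ) + 1) * uniformMean fun a : Fin n → Fin (M + 1) =>
      cellOverflow k (occupancy a 0) * g (vectorOverflow k (occupancy a)) := by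
  have h : ∀ j, (uniformMean fun a : Fin n → Fin (M + 1) =>
      cellOverflow k (occupancy a j) * g (vectorOverflow k (occupancy a))) =
      uniformMean fun a : Fin n → Fin (M + 1) =>
        cellOverflow k (occupancy a 0) * g (vectorOverflow k (occupancy a)) := by
    intro j
    rw [uniformMean_perm (Equiv.swap 0 j)
      fun c => cellOverflow k (c j) * g (vectorOverflow k c)]
    simp only [vectorOverflow_perm, Equiv.swap_apply_right]
  have e : ∀ a : Fin n → Fin (M + 1),
      vectorOverflow k (occupancy a) * g (vectorOverflow k (occupancy a)) =
      ∑ j, cellOverflow k (occupancy a j) * g (vectorOverflow k (occupancy a)) := fun a => by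
    rw [← Finset.sum_mul]; rfl
  simp only [e]
  rw [uniformMean_sum]
  simp [h]

lemma uniformMean_cellOverflow_mul_vectorOverflow {n M : ℕ} (k : ℕ) (i : Fin (M + 1))
    (hi : i ≠ 0) :
    (uniformMean fun a : Fin n → Fin (M + 1) =>
      cellOverflow k (occupancy a 0) * vectorOverflow k (occupancy a)) =
    (uniformMean fun a : Fin n → Fin (M + 1) => cellOverflow k (occupancy a 0) ^ 2) +
      M * uniformMean fun a : Fin n → Fin (M + 1) =>
        cellOverflow k (occupancy a 0) * cellOverflow k (occupancy a i) := by
  have h : ∀ j : Fin M, (uniformMean fun a : Fin n → Fin (M + 1) =>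
      cellOverflow k (occupancy a 0) * cellOverflow k (occupancy a j.succ)) =
      uniformMean fun a : Fin n → Fin (M + 1) =>
        cellOverflow k (occupancy a 0) * cellOverflow k (occupancy a i) := by
    intro j
    rw [uniformMean_perm (Equiv.swap i j.succ)
      fun c => cellOverflow k (c 0) * cellOverflow k (c j.succ)]
    simp only [Equiv.swap_apply_right]
    rw [Equiv.swap_apply_of_ne_of_ne hi.symm (Fin.succ_ne_zero j).symm]
  have e : ∀ a : Fin n → Fin (M + 1),
      cellOverflow k (occupancy a 0) * vectorOverflow k (occupancy a) =
      cellOverflow k (occupancy a 0) ^ 2 +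
        ∑ j : Fin M, cellOverflow k (occupancy a 0) * cellOverflow k (occupancy a j.succ) :=
    fun a => by
      rw [vectorOverflow_succ, ← Finset.mul_sum]
      simp only [vectorOverflow]
      ring
  simp only [e]
  rw [uniformMean_add, uniformMean_sum]
  simp [h]

lemma uniformMean_overflow_dominated {n M : ℕ} (k : ℕ) (hM : 0 < M) {φ : ℝ → ℝ}
    (hφ : Monotone φ) :
    (uniformMean fun a : Fin n → Fin (M + 1) =>
      cellOverflow k (occupancy a 0) * φ (vectorOverflow k (occupancy a))) ≤
    uniformMean fun a : Fin n → Fin (M + 1) => uniformMean fun b : Fin n → Fin (M + 1) =>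
      cellOverflow k (occupancy a 0) *
        φ (vectorOverflow k (occupancy b) + cellOverflow k (occupancy a 0)) := by
  have h := sum_overflow_mul_le (k := k) (n := n) hM hφ
  have hc : (Fintype.card (Fin n → Fin (M + 1)) : ℝ) = ((M : ℝ) + 1) ^ n := by simp
  simp only [uniformMean, hc, ← Finset.sum_div]
  gcongr
  rwa [le_div_iff₀ (by positivity), mul_comm]

end Exchangeability

/-! ### From the probability space to counting. -/

section Transfer

variable {Ω : Type*} [MeasurableSpace Ω] {P : Measure Ω} [IsProbabilityMeasure P] {n m : ℕ}
  {X : Fin n → Ω → Fin m}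

/-- Independent uniform allocations have the uniform law on the space of allocations. -/
lemma integral_allocation (hX_meas : ∀ i, Measurable (X i)) (hX_indep : iIndepFun X P)
    (hX_unif : ∀ i j, P {ω | X i ω = j} = ENNReal.ofReal (1 / (m : ℝ)))
    (F : (Fin n → Fin m) → ℝ) : ∫ ω, F (fun i => X i ω) ∂P = uniformMean F := by
  have hmeas : Measurable fun ω i => X i ω := measurable_pi_lambda _ hX_meas
  have hlaw := (iIndepFun_iff_map_fun_eq_pi_map fun i => (hX_meas i).aemeasurable).1 hX_indep
  have : IsProbabilityMeasure (P.map fun ω i => X i ω) :=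
    Measure.isProbabilityMeasure_map hmeas.aemeasurable
  rw [← integral_map (f := F) hmeas.aemeasurable (measurable_of_finite F).aestronglyMeasurable,
    integral_fintype .of_finite, uniformMean, Finset.sum_div]
  refine Finset.sum_congr rfl fun a _ => ?_
  have h1 : ∀ i, P.map (X i) {a i} = ENNReal.ofReal (1 / (m : ℝ)) := fun i => by
    rw [Measure.map_apply (hX_meas i) (MeasurableSet.singleton _)]
    exact hX_unif i (a i)
  have h2 : ∀ i, IsProbabilityMeasure (P.map (X i)) := fun i =>
    Measure.isProbabilityMeasure_map (hX_meas i).aemeasurable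
  rw [measureReal_def, hlaw, Measure.pi_singleton]
  simp only [h1, Finset.prod_const, Finset.card_univ, Fintype.card_fin]
  rw [ENNReal.toReal_pow, ENNReal.toReal_ofReal (by positivity)]
  simp [div_eq_inv_mul]

end Transfer

/-! ### Assembly of the Wasserstein bound. -/

theorem proposition4p5 {Ω : Type*} [MeasurableSpace Ω] (P : Measure Ω) [IsProbabilityMeasure P]
    (n m k : ℕ) (hm : 2 ≤ m)
    (X : Fin n → Ω → Fin m)
    (hX_meas : ∀ i, Measurable (X i))
    (hX_indep : iIndepFun X P)
    (hX_unif : ∀ i j, P {ω | X i ω = j} = ENNReal.ofReal (1 / (m : ℝ)))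
    (Y₁ Y₂ W : Ω → ℝ)
    (hY₁ : Y₁ = urnOverflow X k ⟨0, by omega⟩)
    (hY₂ : Y₂ = urnOverflow X k ⟨1, by omega⟩)
    (hW : W = totalOverflow X k)
    (σ : ℝ) (hσ : σ = Real.sqrt (variance W P)) (hσ_pos : 0 < σ) :
    wassersteinDist (P.map (standardise P W)) (gaussianReal 0 1) ≤
      (((∫ ω, Y₁ ω ^ 3 ∂P) / (σ * ∫ ω, Y₁ ω ^ 2 ∂P)
        + Real.sqrt (8 / Real.pi) * (m : ℝ) * (σ ^ 2)⁻¹ *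
          ((1 - (m : ℝ)) * covariance Y₁ Y₂ P + (∫ ω, Y₁ ω ∂P) ^ 2) : ℝ) : EReal) := by
  obtain ⟨M, rfl⟩ : ∃ M, m = M + 1 := ⟨m - 1, by omega⟩
  have hM : 0 < M := by omega
  have hint := integral_allocation hX_meas hX_indep hX_unif
  have hmeas : Measurable fun ω i => X i ω := measurable_pi_lambda _ hX_meas
  set one : Fin (M + 1) := ⟨1, by omega⟩ with hone
  have hone0 : one ≠ 0 := by simp [hone, Fin.ext_iff]
  set y : (Fin n → Fin (M + 1)) → ℝ := fun a => cellOverflow k (occupancy a 0) with hy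
  set y2 : (Fin n → Fin (M + 1)) → ℝ := fun a => cellOverflow k (occupancy a one) with hy2
  set w : (Fin n → Fin (M + 1)) → ℝ := fun a => vectorOverflow k (occupancy a) with hw
  have eY₁ : Y₁ = fun ω => y fun i => X i ω := hY₁
  have eY₂ : Y₂ = fun ω => y2 fun i => X i ω := hY₂
  have eW : W = fun ω => w fun i => X i ω := hW
  have hWm : Measurable W := by rw [eW]; exact (measurable_of_finite w).comp hmeas
  have iW : ∫ ω, W ω ∂P = uniformMean w := by rw [eW]; exact hint w
  have iY₁ : ∫ ω, Y₁ ω ∂P = uniformMean y := by rw [eY₁]; exact hint y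
  have iY₂ : ∫ ω, Y₂ ω ∂P = uniformMean y2 := by rw [eY₂]; exact hint y2
  have ivar : variance W P = uniformMean (fun a => w a ^ 2) - uniformMean w ^ 2 := by
    rw [variance_eq_integral hWm.aemeasurable, iW, eW]
    rw [hint fun a => (w a - uniformMean w) ^ 2]
    have e : (fun a => (w a - uniformMean w) ^ 2) =
        fun a => w a ^ 2 - (2 * uniformMean w) * w a + uniformMean w ^ 2 := by funext a; ring
    rw [e, uniformMean_add, uniformMean_sub, uniformMean_const_mul, uniformMean_const]
    ring
  have hmean : uniformMean y2 = uniformMean y := by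
    rw [hy2, uniformMean_perm (Equiv.swap 0 one) fun c => cellOverflow k (c one)]
    simp only [Equiv.swap_apply_right, hy]
  have icov : covariance Y₁ Y₂ P = uniformMean (fun a => y a * y2 a) - uniformMean y ^ 2 := by
    rw [covariance, iY₁, iY₂, eY₁, eY₂,
      hint fun a => (y a - uniformMean y) * (y2 a - uniformMean y2), hmean]
    have e : (fun a => (y a - uniformMean y) * (y2 a - uniformMean y)) =
        fun a => y a * y2 a - (uniformMean y * y a + uniformMean y * y2 a) + uniformMean y ^ 2 := by
      funext a; ring
    rw [e, uniformMean_add, uniformMean_sub, uniformMean_add, uniformMean_const_mul,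
      uniformMean_const_mul, uniformMean_const, hmean]
    ring
  have i2 : ∫ ω, Y₁ ω ^ 2 ∂P = uniformMean fun a => y a ^ 2 := by
    rw [eY₁]; exact hint fun a => y a ^ 2
  have i3 : ∫ ω, Y₁ ω ^ 3 ∂P = uniformMean fun a => y a ^ 3 := by
    rw [eY₁]; exact hint fun a => y a ^ 3
  have hσ2 : σ ^ 2 = variance W P := by rw [hσ, Real.sq_sqrt (variance_nonneg _ _)]
  have hyw := uniformMean_cellOverflow_mul_vectorOverflow (n := n) k one hone0
  refine iSup₂_le fun h hh => ?_
  rw [EReal.coe_le_coe_iff]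
  have hstd : Measurable (standardise P W) := (hWm.sub_const _).div_const _
  rw [integral_map hstd.aemeasurable hh.continuous.aestronglyMeasurable]
  have ih : ∫ ω, h (standardise P W ω) ∂P =
      uniformMean fun a => h ((w a - uniformMean w) / σ) := by
    rw [← hint]
    simp only [standardise, iW, ← hσ]
    rw [eW]
  rw [ih, i2, i3, iY₁, icov]
  refine (stein_bound_of_size_bias (Y := y) (W := w) (m := (M : ℝ) + 1) (by positivity)
    (fun a => cellOverflow_nonneg _ _) (fun g => uniformMean_overflow_mul k g)
    (fun φ hφ => uniformMean_overflow_dominated k hM hφ) hσ_pos (hσ2.trans ivar) hh).trans_eq ?_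
  -- Replacing `E[Y₁ W]` by `E[Y₁²] + M E[Y₁ Y₂]` cancels the second moment and turns `δ` into the
  -- covariance expression.
  rw [hyw]
  push_cast
  ring
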